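/- All codes are binary and linear: an $[n,k]$ code is a $k$-dimensional subspace of $\mathbb{F}_2^n$. A code is called $\Delta$-divisible if the Hamming weight of each of its codewords is divisible by $\Delta$; it is called projective if no position is zero in all codewords and no two distinct positions agree in all codewords. Two codes of the same length are isomorphic, written $\cong$, if one arises from the other by a permutation of the positions. The direct sum $C\oplus C'$ consists of all concatenations $(c\mid c')$ with $c\in C$, $c'\in C'$, and $2\cdot C=\{(c\mid c): c\in C\}$ denotes the two-fold repetition of $C$. For $m\ge 2$, let $\mathrm{RM}_2(m)$ be the first order Reed--Muller code of dimension $m$ and length $2^{m-1}$, i.e. the code generated by the rows of the matrix whose columns are all vectors of $\mathbb{F}_2^{m-1}$, together with the all-one word. Let $\mathrm{PC}_2(7)=\{c\in\mathbb{F}_2^8 : c_1+\dots+c_8=0\}$ be the parity check code of dimension $7$. **Theorem.** Let $a\ge 2$ be an integer, $\Delta=2^a$, and let $C$ be a projective $\Delta$-divisible binary $[4\Delta,k]$ code. Then $k\le 2a+4$. Moreover, if $k=2a+4$, then 1. $C\cong \mathrm{RM}_2(a+2)\oplus \mathrm{RM}_2(a+2)$, or 2. $a=2$ and $C\cong\langle\,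 2\cdot \mathrm{PC}_2(7),\ (1111111100000000)\,\rangle$. -/

import Mathlib

/-- A binary linear code whose positions are indexed by `ι`: a subspace of `𝔽₂^ι`. -/
abbrev BinaryCode (ι : Type) : Type := Submodule (ZMod 2) (ι → ZMod 2)

namespace BinaryCode

/-- The code is `Δ`-divisible: the Hamming weight of every codeword is divisible by `Δ`. -/
def IsDivisible {ι : Type} [Fintype ι] (C : BinaryCode ι) (Δ : ℕ) : Prop :=
  ∀ c ∈ C, Δ ∣ hammingNorm c

/-- The code is full-length: no position is zero in all codewords. -/
def IsFullLength {ι : Type} (C : BinaryCode ι) : Prop :=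
  ∀ i : ι, ∃ c ∈ C, c i ≠ 0

/-- Two positions are equivalent if the corresponding columns of a generator matrix are nonzero
scalar multiples of each other; over `𝔽₂` this means that all codewords agree in them. -/
def EquivPositions {ι : Type} (C : BinaryCode ι) (i j : ι) : Prop :=
  ∀ c ∈ C, c i = c j

/-- The code is projective: it is full-length and its maximum multiplicity is at most one, i.e. no
two distinct positions are equivalent. -/
def IsProjective {ι : Type} (C : BinaryCode ι) : Prop :=
  C.IsFullLength ∧ ∀ i j : ι, C.EquivPositions i j → i = j

/-- Isomorphism of binary codes: a bijection of the positions carries `C` onto `D`. When both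
codes are indexed by `Fin n` this is the action of the symmetric group on the positions. -/
def Iso {ι κ : Type} (C : BinaryCode ι) (D : BinaryCode κ) : Prop :=
  ∃ e : ι ≃ κ, ∀ d : κ → ZMod 2, d ∈ D ↔ (fun i => d (e i)) ∈ C

/-- The direct sum of two codes: all concatenations of a codeword of `C` and a codeword of `D`. -/
def directSum {ι κ : Type} (C : BinaryCode ι) (D : BinaryCode κ) : BinaryCode (ι ⊕ κ) where
  carrier := {x | (fun i => x (Sum.inl i)) ∈ C ∧ (fun j => x (Sum.inr j)) ∈ D}
  add_mem' := fun hx hy => ⟨C.add_mem hx.1 hy.1, D.add_mem hx.2 hy.2⟩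
  zero_mem' := ⟨C.zero_mem, D.zero_mem⟩
  smul_mem' := fun r _ hx => ⟨C.smul_mem r hx.1, D.smul_mem r hx.2⟩

/-- The `m`-fold repetition `m · C = {(c | c | ... | c) : c ∈ C}`; the position `(r, i)` is
position `i` in the `r`-th copy. -/
def repetition {ι : Type} (m : ℕ) (C : BinaryCode ι) : BinaryCode (Fin m × ι) :=
  C.map (LinearMap.funLeft (ZMod 2) (ZMod 2) (Prod.snd : Fin m × ι → ι))

/-- The binary first order Reed-Muller code of dimension `k ≥ 2`. The positions are all vectors of
`𝔽₂^(k-1)` (the columns of a matrix with `k - 1` rows); the code is generated by the rows of that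
matrix together with the all-one word. -/
def reedMuller (k : ℕ) : BinaryCode (Fin (k - 1) → ZMod 2) :=
  Submodule.span (ZMod 2)
    (Set.range (fun (i : Fin (k - 1)) (v : Fin (k - 1) → ZMod 2) => v i) ∪ {fun _ => 1})

/-- The binary parity check code of dimension `k`: all words of length `k + 1` with entries
summing to zero. -/
def parityCheck (k : ℕ) : BinaryCode (Fin (k + 1)) where
  carrier := {c | ∑ i, c i = 0}
  add_mem' := by
    intro x y hx hy
    simp only [Set.mem_ofPred_eq] at hx hy ⊢
    simp [Finset.sum_add_distrib, hx, hy]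
  zero_mem' := by simp
  smul_mem' := by
    intro r x hx
    simp only [Set.mem_ofPred_eq] at hx ⊢
    simp [← Finset.mul_sum, hx]

/-- The word `1⁸0⁸` of length `16`, written on the positions of a two-fold repetition of a code of
length `8`: it is one on the first copy and zero on the second copy. -/
def halfOnes : Fin 2 × Fin 8 → ZMod 2 := fun p => if p.1 = 0 then 1 else 0

/-- The code `⟨2 · PC₂(7), (1⁸0⁸)⟩` of length `16`. -/
def extendedDoubleParityCheck : BinaryCode (Fin 2 × Fin 8) :=
  repetition 2 (parityCheck 7) ⊔ Submodule.span (ZMod 2) {halfOnes}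

end BinaryCode

namespace BinaryCode

/-! ### Word arithmetic and the second-moment method -/

section Words

/-! Put `q = 2 ^ (a - 2)`, so that the length is `16 * q` and Δ is `4 * q`. Adjoining the all-one
word keeps the code divisible, so it suffices to bound a code `C` containing it (`IsSaturated`),
whose weights are 0, 4q, 8q, 12q and 16q. The claim becomes |C| ≤ 256q².

Distinct columns make the signs (-1)^(c x), as functions of `c`, orthogonal over the code. Hence the
sum over `c` of `charSum 1 c * charSum 1 (c + u)` is |C| times `charSum 1 u`
(`sum_charSum_mul_charSum`). For a word `u` of weight 4q the positive terms come from 0, u, 1, 1 +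
u, from the light neighbors N of `u`, and from their complements. This gives |C| ≤ 16q(4 + |N|).

It remains to show |N| ≤ 16q - 4. A light neighbor meets `u` in one of 8q - 2 halves. Neighbors with
the same half `h` form a sunflower with kernel `h`: their petals outside `u` are disjoint, of size
2q, in a set of size 12q, so there are at most six. A further neighbor whose trace is neither `h`
nor `u + h` meets every petal in q positions while having only 2q positions outside `u`, so then
there are at most two. Thus |N| ≤ 2(8q - 2) or |N| ≤ 12, and both are at most 16q - 4.

In the case of equality with all fibers of size two, the two petals of a fiber and `u` form a block
of 8q positions carrying all of N. A count with second moments splits `C` along this block into two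
first order Reed–Muller codes. Otherwise 16q - 4 ≤ 12 forces q = 1, and a sunflower with six petals
divides the 16 positions into eight pairs, which yields the doubled parity check code. -/

theorem word_mul_self {ι : Type} (c : ι → ZMod 2) : c * c = c := by
  have key : ∀ x : ZMod 2, x * x = x := by decide
  funext i
  exact key _

theorem word_add_self {ι : Type} (c : ι → ZMod 2) : c + c = 0 := by
  funext i
  exact CharTwo.add_self_eq_zero _

theorem eq_of_word_add_eq_zero {ι : Type} {c d : ι → ZMod 2} (h : c + d = 0) : c = d := by
  funext i
  exact CharTwo.add_eq_zero.1 (congrFun h i)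

/-- The code of all traces of codewords on the support of `g`. -/
def trace {ι : Type} (C : BinaryCode ι) (g : ι → ZMod 2) : BinaryCode ι :=
  C.map (LinearMap.mulLeft (ZMod 2) g)

theorem mem_trace {ι : Type} {C : BinaryCode ι} {g d : ι → ZMod 2} :
    d ∈ trace C g ↔ ∃ c ∈ C, g * c = d := by
  simp [trace]

theorem mul_mem_trace {ι : Type} {C : BinaryCode ι} (g : ι → ZMod 2) {c : ι → ZMod 2} (hc : c ∈ C) :
    g * c ∈ trace C g :=
  mem_trace.2 ⟨c, hc, rfl⟩

theorem mul_eq_self_of_mem_trace {ι : Type} {C : BinaryCode ι} {g d : ι → ZMod 2} (hd : d ∈ trace C g) :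
    d * g = d := by
  obtain ⟨c, _, rfl⟩ := mem_trace.1 hd
  rw [mul_comm, ← mul_assoc, word_mul_self]

variable {ι : Type} [Fintype ι]

theorem hammingNorm_eq_sum_val (c : ι → ZMod 2) : hammingNorm c = ∑ i, (c i).val := by
  have key : ∀ x : ZMod 2, x.val = if x ≠ 0 then 1 else 0 := by decide
  simp only [hammingNorm, Finset.card_filter, key]

theorem hammingNorm_add_add_two_mul (c d : ι → ZMod 2) :
    hammingNorm (c + d) + 2 * hammingNorm (c * d) = hammingNorm c + hammingNorm d := by
  have key : ∀ x y : ZMod 2, (x + y).val + 2 * (x * y).val = x.val + y.val := by decide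
  simp only [hammingNorm_eq_sum_val, Finset.mul_sum, ← Finset.sum_add_distrib]
  exact Finset.sum_congr rfl fun i _ => key _ _

/-- The code tells apart any two positions in the support of `g`. -/
def Separates {ι : Type} (D : BinaryCode ι) (g : ι → ZMod 2) : Prop :=
  ∀ x y, g x = 1 → g y = 1 → (∀ c ∈ D, c x = c y) → x = y

theorem separates_trace {ι : Type} {C : BinaryCode ι} {g : ι → ZMod 2} (h : C.Separates 1) :
    (trace C g).Separates g := by
  intro x y hx hy hxy
  refine h x y rfl rfl fun c hc => ?_
  simpa [hx, hy] using hxy _ (mul_mem_trace g hc)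

theorem hammingNorm_one_word : hammingNorm (1 : ι → ZMod 2) = Fintype.card ι := by
  simp [hammingNorm_eq_sum_val, ZMod.val_one]

theorem hammingNorm_add_of_mul_eq_zero {c d : ι → ZMod 2} (h : c * d = 0) :
    hammingNorm (c + d) = hammingNorm c + hammingNorm d := by
  have := hammingNorm_add_add_two_mul c d
  rw [h, hammingNorm_zero] at this
  omega

theorem hammingNorm_mul_add_mul_compl (c u : ι → ZMod 2) :
    hammingNorm (c * u) + hammingNorm (c * (1 + u)) = hammingNorm c := by
  have key : ∀ x y : ZMod 2, (x * y).val + (x * (1 + y)).val = x.val := by decide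
  simp only [hammingNorm_eq_sum_val, ← Finset.sum_add_distrib]
  exact Finset.sum_congr rfl fun i _ => key _ _

theorem hammingNorm_mul_le_left (c u : ι → ZMod 2) : hammingNorm (c * u) ≤ hammingNorm c := by
  have := hammingNorm_mul_add_mul_compl c u
  omega

theorem hammingNorm_one_add (c : ι → ZMod 2) :
    hammingNorm c + hammingNorm (1 + c) = Fintype.card ι := by
  have := hammingNorm_mul_add_mul_compl 1 c
  rwa [one_mul, one_mul, hammingNorm_one_word] at this

theorem eq_of_hammingNorm_mul_eq {c d : ι → ZMod 2} (h : hammingNorm (c * d) = hammingNorm c) :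
    c * d = c := by
  have h1 := hammingNorm_mul_add_mul_compl c d
  have h2 : c * (1 + d) = 0 := hammingNorm_eq_zero.1 (by omega)
  rw [mul_add, mul_one] at h2
  exact (eq_of_word_add_eq_zero h2).symm

theorem eq_one_of_hammingNorm_eq_card {c : ι → ZMod 2} (h : hammingNorm c = Fintype.card ι) :
    c = 1 := by
  have h1 := hammingNorm_one_add c
  have h2 : 1 + c = 0 := hammingNorm_eq_zero.1 (by omega)
  exact (eq_of_word_add_eq_zero h2).symm

/-- Words with pairwise disjoint supports: the weights of their traces on `w` add up. -/
theorem sum_hammingNorm_mul {κ : Type} (F : Finset κ) (p : κ → ι → ZMod 2)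
    (hp : ∀ v ∈ F, ∀ v' ∈ F, v ≠ v' → p v * p v' = 0) (w : ι → ZMod 2) :
    ∑ v ∈ F, hammingNorm (w * p v) = hammingNorm (w * ∑ v ∈ F, p v) := by
  classical
  induction F using Finset.induction_on with
  | empty => simp
  | insert v F hv ih =>
    rw [Finset.sum_insert hv, Finset.sum_insert hv, mul_add, hammingNorm_add_of_mul_eq_zero,
      ih fun x hx y hy => hp x (Finset.mem_insert_of_mem hx) y (Finset.mem_insert_of_mem hy)]
    rw [mul_mul_mul_comm, Finset.mul_sum, Finset.sum_eq_zero, mul_zero]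
    intro x hx
    exact hp v (Finset.mem_insert_self v F) x (Finset.mem_insert_of_mem hx)
      (fun h => hv (h ▸ hx))

/-- The codewords of a code, as a finite set. -/
noncomputable def words (D : BinaryCode ι) : Finset (ι → ZMod 2) :=
  (Set.toFinite (D : Set (ι → ZMod 2))).toFinset

@[simp]
theorem mem_words {D : BinaryCode ι} {c : ι → ZMod 2} : c ∈ words D ↔ c ∈ D := by
  simp [words]

theorem card_words (D : BinaryCode ι) : (words D).card = 2 ^ Module.finrank (ZMod 2) D := by
  have h := Module.natCard_eq_pow_finrank (K := ZMod 2) (V := D)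
  rw [Nat.card_zmod] at h
  rw [← h, words, ← Set.ncard_eq_toFinset_card]
  rfl

/-- The number of zeros minus the number of ones of `c` inside the support of `g`. -/
def charSum (g c : ι → ZMod 2) : ℤ := hammingNorm g - 2 * hammingNorm (g * c)

/-- The sign `(-1) ^ x`. -/
def bitSign (x : ZMod 2) : ℤ := 1 - 2 * x.val

theorem bitSign_add (x y : ZMod 2) : bitSign (x + y) = bitSign x * bitSign y := by
  revert x y
  decide

theorem charSum_eq_sum (g c : ι → ZMod 2) :
    charSum g c = ∑ x, ((g x).val : ℤ) * bitSign (c x) := by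
  have key : ∀ x y : ZMod 2, (x.val : ℤ) * bitSign y = x.val - 2 * (x * y).val := by decide
  simp only [charSum, hammingNorm_eq_sum_val, key, Finset.sum_sub_distrib, Nat.cast_sum,
    Finset.mul_sum, Pi.mul_apply]

/-- Translation by `d` permutes the code and flips the sign of every summand. -/
theorem sum_bitSign_eq_zero {D : BinaryCode ι} {x y : ι} {d : ι → ZMod 2} (hd : d ∈ D)
    (hxy : d x ≠ d y) : ∑ c ∈ words D, bitSign (c x) * bitSign (c y) = 0 := by
  have key : ∀ a b : ZMod 2, a ≠ b → bitSign a * bitSign b = -1 := by decide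
  have h : ∑ c ∈ words D, bitSign (c x) * bitSign (c y) =
      ∑ c ∈ words D, -(bitSign (c x) * bitSign (c y)) := by
    refine Finset.sum_bij' (fun c _ => c + d) (fun c _ => c + d) ?_ ?_ ?_ ?_ ?_
    · intro c hc
      exact mem_words.2 (D.add_mem (mem_words.1 hc) hd)
    · intro c hc
      exact mem_words.2 (D.add_mem (mem_words.1 hc) hd)
    · intro c _
      rw [add_assoc, word_add_self, add_zero]
    · intro c _
      rw [add_assoc, word_add_self, add_zero]
    · intro c _
      simp only [Pi.add_apply, bitSign_add]
      rw [mul_mul_mul_comm, key _ _ hxy]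
      ring
  rw [Finset.sum_neg_distrib] at h
  omega

/-- Expand the product over pairs of positions in the support of `g`. Off the diagonal some codeword
distinguishes the two positions, so the sum over the code vanishes; the diagonal gives the
right-hand side. -/
theorem sum_charSum_mul_charSum {D : BinaryCode ι} {g : ι → ZMod 2} (hsep : D.Separates g)
    (u : ι → ZMod 2) :
    ∑ c ∈ words D, charSum g c * charSum g (c + u) = (words D).card * charSum g u := by
  have hself : ∀ a : ZMod 2, bitSign a * bitSign a = 1 := by decide
  have hval : ∀ a : ZMod 2, (a.val : ℤ) * a.val = a.val := by decide
  have h01 : ∀ a : ZMod 2, a = 1 ∨ a.val = 0 := by decide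
  have h1 : ∀ c ∈ words D, charSum g c * charSum g (c + u) =
      ∑ x, ∑ y, (((g x).val : ℤ) * (g y).val * bitSign (u y)) *
        (bitSign (c x) * bitSign (c y)) := by
    intro c _
    rw [charSum_eq_sum, charSum_eq_sum, Finset.sum_mul_sum]
    refine Finset.sum_congr rfl fun x _ => Finset.sum_congr rfl fun y _ => ?_
    rw [Pi.add_apply, bitSign_add]
    ring
  rw [Finset.sum_congr rfl h1, Finset.sum_comm, charSum_eq_sum, Finset.mul_sum]
  refine Finset.sum_congr rfl fun x _ => ?_
  rw [Finset.sum_comm, Finset.sum_eq_single x]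
  · rw [← Finset.mul_sum]
    simp only [hself, Finset.sum_const, nsmul_eq_mul, mul_one, hval]
    ring
  · intro y _ hyx
    rw [← Finset.mul_sum]
    rcases h01 (g x) with hx | hx
    · rcases h01 (g y) with hy | hy
      · have : ∃ d ∈ D, d x ≠ d y := by
          by_contra! hcon
          exact hyx (hsep x y hx hy hcon).symm
        obtain ⟨d, hd, hne⟩ := this
        rw [sum_bitSign_eq_zero hd hne, mul_zero]
      · simp [hy]
    · simp [hx]
  · intro h
    exact absurd (Finset.mem_univ x) h

theorem sum_charSum_sq {D : BinaryCode ι} {g : ι → ZMod 2} (hsep : D.Separates g) :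
    ∑ c ∈ words D, charSum g c ^ 2 = (words D).card * hammingNorm g := by
  have h := sum_charSum_mul_charSum hsep 0
  simp only [add_zero] at h
  rw [Finset.sum_congr rfl fun c _ => pow_two (charSum g c), h]
  simp [charSum]

variable {D : BinaryCode ι} {g : ι → ZMod 2}

/-- Only 0 and `g` have a nonzero character sum, so the second moment reads 2·wt(g)² = |D|·wt(g). -/
theorem card_words_of_balanced (hsep : D.Separates g) (hg : g ∈ D) (hg0 : g ≠ 0)
    (hbal : ∀ d ∈ D, d = 0 ∨ d = g ∨ (d * g = d ∧ 2 * hammingNorm d = hammingNorm g)) :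
    (words D).card = 2 * hammingNorm g := by
  classical
  have h := sum_charSum_sq hsep
  rw [← Finset.sum_subset (s₁ := {0, g})] at h
  · rw [Finset.sum_pair hg0.symm] at h
    simp only [charSum, mul_zero, hammingNorm_zero, word_mul_self] at h
    have hpos : (hammingNorm g : ℤ) ≠ 0 := by simpa using hg0
    have h2 : (hammingNorm g : ℤ) * (2 * hammingNorm g) =
        hammingNorm g * (words D).card := by
      rw [mul_comm (hammingNorm g : ℤ) ((words D).card : ℤ), ← h]
      push_cast
      ring
    exact_mod_cast (mul_left_cancel₀ hpos h2).symm
  · intro d hd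
    rcases Finset.mem_insert.1 hd with rfl | hd
    · exact mem_words.2 D.zero_mem
    · rw [Finset.mem_singleton.1 hd]
      exact mem_words.2 hg
  · intro d hd hd'
    simp only [Finset.mem_insert, Finset.mem_singleton, not_or] at hd'
    rcases hbal d (mem_words.1 hd) with h | h | ⟨h1, h2⟩
    · exact absurd h hd'.1
    · exact absurd h hd'.2
    · rw [charSum, mul_comm g d, h1, ← h2]
      push_cast
      ring

/-- Conversely, 0 and `g` alone already exhaust a second moment of at most 2·wt(g)², so every other
character sum is zero. -/
theorem balanced_of_card_words_le (hsep : D.Separates g) (hg : g ∈ D) (hg0 : g ≠ 0)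
    (hD : ∀ d ∈ D, d * g = d) (hcard : (words D).card ≤ 2 * hammingNorm g) :
    ∀ d ∈ D, d = 0 ∨ d = g ∨ (d * g = d ∧ 2 * hammingNorm d = hammingNorm g) := by
  classical
  intro d hd
  by_contra! hcon
  obtain ⟨hd0, hdg, hne⟩ := hcon
  have h := sum_charSum_sq hsep
  have hsub : ({0, g, d} : Finset (ι → ZMod 2)) ⊆ words D := by
    intro x hx
    simp only [Finset.mem_insert, Finset.mem_singleton] at hx
    rcases hx with rfl | rfl | rfl
    · exact mem_words.2 D.zero_mem
    · exact mem_words.2 hg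
    · exact mem_words.2 hd
  have hle := Finset.sum_le_sum_of_subset_of_nonneg hsub
    (f := fun c => charSum g c ^ 2) fun c _ _ => sq_nonneg _
  rw [h, Finset.sum_insert (by simp [hg0.symm, hd0.symm]), Finset.sum_pair hdg.symm] at hle
  simp only [charSum, mul_zero, hammingNorm_zero, word_mul_self] at hle
  rw [mul_comm g d, hD d hd] at hle
  have hpos : ((hammingNorm g : ℤ) - 2 * hammingNorm d) ^ 2 > 0 := by
    have : (hammingNorm g : ℤ) - 2 * hammingNorm d ≠ 0 := by
      have := hne (hD d hd)
      omega
    positivity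
  have h3 : ((words D).card : ℤ) * hammingNorm g ≤ (2 * hammingNorm g) * hammingNorm g :=
    mul_le_mul_of_nonneg_right (by exact_mod_cast hcard) (by positivity)
  push_cast at hle
  nlinarith

end Words

/-! ### Light words, their neighbors and the correlation bound -/

section LightWords

variable {ι : Type} [Fintype ι]

/-- The light codewords (of weight `4 * q`) which meet the light word `u` in half of its support,
i.e. whose sum with `u` is light as well. -/
noncomputable def lightNeighbors (C : BinaryCode ι) (q : ℕ) (u : ι → ZMod 2) :
    Finset (ι → ZMod 2) :=
  (words C).filter fun v => hammingNorm v = 4 * q ∧ hammingNorm (v + u) = 4 * q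

theorem mem_lightNeighbors {C : BinaryCode ι} {q : ℕ} {u v : ι → ZMod 2} :
    v ∈ lightNeighbors C q u ↔ v ∈ C ∧ hammingNorm v = 4 * q ∧ hammingNorm (v + u) = 4 * q := by
  simp [lightNeighbors]

/-- The light neighbors of `u` with a prescribed trace on `u`. -/
noncomputable def lightFiber (C : BinaryCode ι) (q : ℕ) (u h : ι → ZMod 2) :
    Finset (ι → ZMod 2) :=
  (lightNeighbors C q u).filter fun v => u * v = h

theorem mem_lightFiber {C : BinaryCode ι} {q : ℕ} {u h v : ι → ZMod 2} :
    v ∈ lightFiber C q u h ↔ v ∈ lightNeighbors C q u ∧ u * v = h := by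
  simp [lightFiber]

/-- A `4 * q`-divisible code of length `16 * q` which separates positions and contains the all-one
word. -/
structure IsSaturated (C : BinaryCode ι) (q : ℕ) : Prop where
  pos : 0 < q
  card : Fintype.card ι = 16 * q
  one_mem : 1 ∈ C
  dvd : ∀ c ∈ C, 4 * q ∣ hammingNorm c
  sep : C.Separates 1

variable {C : BinaryCode ι} {q : ℕ} {u : ι → ZMod 2}

theorem IsSaturated.weight_cases (hC : C.IsSaturated q) {c : ι → ZMod 2} (hc : c ∈ C) :
    c = 0 ∨ hammingNorm c = 4 * q ∨ hammingNorm c = 8 * q ∨ hammingNorm c = 12 * q ∨ c = 1 := by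
  obtain ⟨m, hm⟩ := hC.dvd c hc
  have hle : hammingNorm c ≤ 16 * q := by
    rw [← hC.card]
    exact hammingNorm_le_card_fintype
  have hm4 : m ≤ 4 := by
    by_contra hcon
    have : 4 * q * 5 ≤ 4 * q * m := Nat.mul_le_mul_left _ (by omega)
    have := hC.pos
    omega
  interval_cases m
  · exact Or.inl (hammingNorm_eq_zero.1 (by omega))
  · omega
  · omega
  · omega
  · exact Or.inr (Or.inr (Or.inr (Or.inr (eq_one_of_hammingNorm_eq_card (by
      rw [hC.card]
      omega)))))

theorem charSum_one (hC : C.IsSaturated q) (c : ι → ZMod 2) :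
    charSum 1 c = 16 * q - 2 * hammingNorm c := by
  rw [charSum, one_mul, hammingNorm_one_word, hC.card]
  push_cast
  ring

/-- If there are no light words, the code is small. -/
theorem IsSaturated.card_words_le_of_no_light (hC : C.IsSaturated q)
    (hno : ∀ c ∈ C, hammingNorm c ≠ 4 * q) : (words C).card ≤ 32 * q := by
  have h : (words C).card = 2 * hammingNorm (1 : ι → ZMod 2) := by
    refine card_words_of_balanced hC.sep hC.one_mem ?_ fun d hd => ?_
    · intro h
      have h1 := hammingNorm_one_word (ι := ι)
      have := hC.pos
      rw [h, hammingNorm_zero, hC.card] at h1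
      omega
    · rw [mul_one, hammingNorm_one_word, hC.card]
      have h12 : hammingNorm d ≠ 12 * q := by
        intro h
        have h1 := hammingNorm_one_add d
        rw [hC.card] at h1
        exact hno (1 + d) (C.add_mem hC.one_mem hd) (by omega)
      rcases hC.weight_cases hd with h | h | h | h | h
      · exact Or.inl h
      · exact absurd h (hno d hd)
      · exact Or.inr (Or.inr ⟨rfl, by omega⟩)
      · exact absurd h h12
      · exact Or.inr (Or.inl h)
  rw [h, hammingNorm_one_word, hC.card]
  omega

/-- A lower bound for the number of light neighbors of a light word. -/
theorem IsSaturated.card_words_le_lightNeighbors (hC : C.IsSaturated q) (hu : u ∈ C)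
    (hu4 : hammingNorm u = 4 * q) :
    (words C).card ≤ 16 * q * (4 + (lightNeighbors C q u).card) := by
  classical
  have hq : (0 : ℤ) < q := by exact_mod_cast hC.pos
  let N := lightNeighbors C q u
  let Z : Finset (ι → ZMod 2) := {0, u, 1, 1 + u}
  have hsum := sum_charSum_mul_charSum hC.sep u
  -- The summand is 128q² on `Z`. Elsewhere it is 64q² if `c` and `c + u` are both of weight 4q or
  -- both of weight 12q (then `1 + c` lies in `N`), and it is at most 0 in the remaining cases.
  have hbound : ∀ c ∈ words C, charSum 1 c * charSum 1 (c + u) ≤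
      64 * q ^ 2 * (2 * (if c ∈ Z then 1 else 0) + (if c ∈ N then 1 else 0)
        + (if 1 + c ∈ N then 1 else 0)) := by
    intro c hc
    have hcC := mem_words.1 hc
    rw [charSum_one hC, charSum_one hC]
    have hZ0 : ∀ P R : Prop, ∀ [Decidable P] [Decidable R],
        (0 : ℤ) ≤ (if P then 1 else 0) + (if R then 1 else 0) := by
      intro P R _ _
      split_ifs <;> norm_num
    have hnn := hZ0 (c ∈ N) (1 + c ∈ N)
    have hcompl : ∀ d : ι → ZMod 2, hammingNorm d + hammingNorm (1 + d) = 16 * q := by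
      intro d
      rw [hammingNorm_one_add, hC.card]
    by_cases hcZ : c ∈ Z
    · have h1 := hcompl u
      have hval : ((16 * q - 2 * hammingNorm c : ℤ)) * (16 * q - 2 * hammingNorm (c + u)) =
          64 * q ^ 2 * 2 := by
        simp only [Z, Finset.mem_insert, Finset.mem_singleton] at hcZ
        have hone : hammingNorm (1 : ι → ZMod 2) = 16 * q := by
          rw [hammingNorm_one_word, hC.card]
        have h12 : hammingNorm (1 + u) = 12 * q := by omega
        rcases hcZ with rfl | rfl | rfl | rfl
        · rw [zero_add, hu4, hammingNorm_zero]
          push_cast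
          ring
        · rw [word_add_self, hu4, hammingNorm_zero]
          push_cast
          ring
        · rw [hone, h12]
          push_cast
          ring
        · rw [add_assoc, word_add_self, add_zero, hone, h12]
          push_cast
          ring
      rw [hval, if_pos hcZ]
      nlinarith [mul_nonneg (mul_nonneg (by norm_num : (0 : ℤ) ≤ 64) (sq_nonneg (q : ℤ))) hnn]
    · rw [if_neg hcZ]
      simp only [Z, Finset.mem_insert, Finset.mem_singleton, not_or] at hcZ
      obtain ⟨hc0, hcu, hc1, hc1u⟩ := hcZ
      have hrest : (0 : ℤ) ≤ 64 * q ^ 2 * (2 * 0 + (if c ∈ N then 1 else 0)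
          + (if 1 + c ∈ N then 1 else 0)) := by
        rw [mul_zero, zero_add]
        positivity
      have hcu0 : c + u ≠ 0 := fun h => hcu (eq_of_word_add_eq_zero h)
      have hcu1 : c + u ≠ 1 := fun h => hc1u (by
        rw [← h, add_assoc, word_add_self, add_zero])
      have hcuC := C.add_mem hcC hu
      rcases hC.weight_cases hcC with h | h | h | h | h
      · exact absurd h hc0
      · rcases hC.weight_cases hcuC with h' | h' | h' | h' | h'
        · exact absurd h' hcu0
        · have hN : c ∈ N := mem_lightNeighbors.2 ⟨hcC, h, h'⟩
          rw [h, h', if_pos hN]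
          push_cast
          split_ifs <;> nlinarith
        · refine le_trans (le_of_eq ?_) hrest
          rw [h']
          push_cast
          ring
        · refine le_trans ?_ hrest
          rw [h, h']
          push_cast
          nlinarith
        · exact absurd h' hcu1
      · refine le_trans (le_of_eq ?_) hrest
        rw [h]
        push_cast
        ring
      · rcases hC.weight_cases hcuC with h' | h' | h' | h' | h'
        · exact absurd h' hcu0
        · refine le_trans ?_ hrest
          rw [h, h']
          push_cast
          nlinarith
        · refine le_trans (le_of_eq ?_) hrest
          rw [h']
          push_cast
          ring
        · have hN : 1 + c ∈ N := by
            refine mem_lightNeighbors.2 ⟨C.add_mem hC.one_mem hcC, ?_, ?_⟩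
            · have := hcompl c
              omega
            · have := hcompl (c + u)
              rw [add_assoc]
              omega
          rw [h, h', if_pos hN]
          push_cast
          split_ifs <;> nlinarith
        · exact absurd h' hcu1
      · exact absurd h hc1
  have hle := Finset.sum_le_sum hbound
  have hcount : ∀ (S : Finset (ι → ZMod 2)),
      ∑ c ∈ words C, (if c ∈ S then (1 : ℤ) else 0) ≤ S.card := by
    intro S
    rw [Finset.sum_boole]
    exact_mod_cast Finset.card_le_card fun x hx => (Finset.mem_filter.1 hx).2
  have hcount' : ∑ c ∈ words C, (if 1 + c ∈ N then (1 : ℤ) else 0) ≤ N.card := by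
    rw [Finset.sum_boole]
    refine Int.ofNat_le.2 (Finset.card_le_card_of_injOn (fun c => 1 + c) ?_ ?_)
    · intro x hx
      exact (Finset.mem_filter.1 hx).2
    · intro x _ y _ hxy
      exact add_left_cancel hxy
  rw [hsum, charSum_one hC, hu4, ← Finset.mul_sum, Finset.sum_add_distrib,
    Finset.sum_add_distrib, ← Finset.mul_sum] at hle
  have hZ : (Z.card : ℤ) ≤ 4 := by exact_mod_cast Finset.card_le_four
  have hfin : ((words C).card : ℤ) * (16 * q - 2 * (4 * q : ℕ)) ≤
      64 * q ^ 2 * (2 * 4 + N.card + N.card) := by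
    refine hle.trans (mul_le_mul_of_nonneg_left ?_ (by positivity))
    linarith [hcount Z, hcount N]
  push_cast at hfin
  have hfin2 : (8 * q : ℤ) * (words C).card ≤ (8 * q) * (16 * q * (4 + N.card)) := by
    linarith
  exact_mod_cast le_of_mul_le_mul_left hfin2 (by positivity)

/-- Any two codewords meet in an even multiple of `q` positions. -/
theorem IsSaturated.dvd_mul (hC : C.IsSaturated q) {c d : ι → ZMod 2} (hc : c ∈ C) (hd : d ∈ C) :
    2 * q ∣ hammingNorm (c * d) := by
  have h := hammingNorm_add_add_two_mul c d
  have h2 : 4 * q ∣ hammingNorm (c + d) + 2 * hammingNorm (c * d) := by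
    rw [h]
    exact (hC.dvd c hc).add (hC.dvd d hd)
  have h3 := (Nat.dvd_add_right (hC.dvd _ (C.add_mem hc hd))).1 h2
  rw [show 4 * q = 2 * (2 * q) by ring] at h3
  exact (Nat.mul_dvd_mul_iff_left (by norm_num)).1 h3

/-- The intersection is an even multiple of q inside a set of size 4q. This trichotomy drives all
the sunflower arguments. -/
theorem IsSaturated.trace_cases (hC : C.IsSaturated q) {u c : ι → ZMod 2} (hu : u ∈ C)
    (hu4 : hammingNorm u = 4 * q) (hc : c ∈ C) :
    u * c = 0 ∨ u * c = u ∨ hammingNorm (u * c) = 2 * q := by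
  obtain ⟨m, hm⟩ := hC.dvd_mul hu hc
  have hle := hammingNorm_mul_le_left u c
  have hm2 : m ≤ 2 := by
    by_contra hcon
    have : 2 * q * 3 ≤ 2 * q * m := Nat.mul_le_mul_left _ (by omega)
    have := hC.pos
    omega
  interval_cases m
  · exact Or.inl (hammingNorm_eq_zero.1 (by omega))
  · omega
  · exact Or.inr (Or.inl (eq_of_hammingNorm_mul_eq (by omega)))

theorem IsSaturated.ne_zero (hC : C.IsSaturated q) (hu4 : hammingNorm u = 4 * q) : u ≠ 0 := by
  rintro rfl
  have := hC.pos
  rw [hammingNorm_zero] at hu4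
  omega

/-- By the trichotomy the trace code on `u` is balanced, so it has twice as many words as `u` has
ones. -/
theorem IsSaturated.card_trace (hC : C.IsSaturated q) (hu : u ∈ C)
    (hu4 : hammingNorm u = 4 * q) : (words (trace C u)).card = 8 * q := by
  rw [card_words_of_balanced (separates_trace hC.sep) (g := u), hu4]
  · ring
  · exact mem_trace.2 ⟨u, hu, word_mul_self u⟩
  · exact hC.ne_zero hu4
  · intro d hd
    have hself := mul_eq_self_of_mem_trace hd
    obtain ⟨c, hc, rfl⟩ := mem_trace.1 hd
    rcases hC.trace_cases hu hu4 hc with h | h | h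
    · exact Or.inl h
    · exact Or.inr (Or.inl h)
    · exact Or.inr (Or.inr ⟨hself, by omega⟩)

theorem IsSaturated.trace_lightNeighbor (_hC : C.IsSaturated q)
    (hu4 : hammingNorm u = 4 * q) {v : ι → ZMod 2} (hv : v ∈ lightNeighbors C q u) :
    hammingNorm (u * v) = 2 * q := by
  obtain ⟨_, h1, h2⟩ := mem_lightNeighbors.1 hv
  have := hammingNorm_add_add_two_mul v u
  rw [mul_comm]
  omega

/-- The possible traces of light neighbors. -/
noncomputable def halves (C : BinaryCode ι) (u : ι → ZMod 2) : Finset (ι → ZMod 2) :=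
  open Classical in (words (trace C u)).erase 0 |>.erase u

theorem IsSaturated.card_halves (hC : C.IsSaturated q) (hu : u ∈ C)
    (hu4 : hammingNorm u = 4 * q) : (halves C u).card = 8 * q - 2 := by
  classical
  have h := hC.card_trace hu hu4
  have hu0 := hC.ne_zero hu4
  have h0 : (0 : ι → ZMod 2) ∈ words (trace C u) := mem_words.2 (Submodule.zero_mem _)
  have h1 : u ∈ words (trace C u) := mem_words.2 (mem_trace.2 ⟨u, hu, word_mul_self u⟩)
  unfold halves
  rw [Finset.card_erase_of_mem, Finset.card_erase_of_mem, h]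
  · omega
  · convert h0
  · convert Finset.mem_erase.2 ⟨hu0, h1⟩

theorem IsSaturated.trace_mem_halves (hC : C.IsSaturated q)
    (hu4 : hammingNorm u = 4 * q) {v : ι → ZMod 2} (hv : v ∈ lightNeighbors C q u) :
    u * v ∈ halves C u := by
  classical
  have h := hC.trace_lightNeighbor hu4 hv
  have hpos := hC.pos
  unfold halves
  simp only [Finset.mem_erase, mem_words]
  refine ⟨fun h' => ?_, fun h' => ?_, mul_mem_trace u (mem_lightNeighbors.1 hv).1⟩
  · rw [h'] at h
    omega
  · rw [h', hammingNorm_zero] at h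
    omega

theorem IsSaturated.card_lightNeighbors_eq_sum (hC : C.IsSaturated q)
    (hu4 : hammingNorm u = 4 * q) :
    (lightNeighbors C q u).card = ∑ h ∈ halves C u, (lightFiber C q u h).card :=
  Finset.card_eq_sum_card_fiberwise fun _ hv => hC.trace_mem_halves hu4 hv

end LightWords

/-! ### Sunflowers of light neighbors -/

section Fibers

variable {ι : Type} [Fintype ι] {C : BinaryCode ι} {q : ℕ} {u h v v' w : ι → ZMod 2}

/-- The intersection of `v` and `v'` contains `h`, of weight 2q, and has weight 0, 2q or 4q. It is
not empty, and weight 4q would give `v = v'`; so it is exactly `h`. -/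
theorem IsSaturated.mul_eq_of_mem_lightFiber (hC : C.IsSaturated q) (hu4 : hammingNorm u = 4 * q)
    (hv : v ∈ lightFiber C q u h) (hv' : v' ∈ lightFiber C q u h) (hne : v ≠ v') :
    v * v' = h := by
  obtain ⟨hvN, rfl⟩ := mem_lightFiber.1 hv
  obtain ⟨hvN', hh⟩ := mem_lightFiber.1 hv'
  obtain ⟨hvC, hv4, _⟩ := mem_lightNeighbors.1 hvN
  obtain ⟨hvC', hv4', _⟩ := mem_lightNeighbors.1 hvN'
  have hpos := hC.pos
  have h2 := hC.trace_lightNeighbor hu4 hvN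
  have htr : v * v' * u = u * v := by
    calc v * v' * u = v * (u * v') := by ring
      _ = u * (v * v) := by rw [hh]; ring
      _ = u * v := by rw [word_mul_self]
  rcases hC.trace_cases hvC hv4 hvC' with h0 | h0 | h0
  · rw [h0, zero_mul] at htr
    rw [← htr, hammingNorm_zero] at h2
    omega
  · have h1 : v' * v = v' := eq_of_hammingNorm_mul_eq (by rw [mul_comm, h0, hv4, hv4'])
    rw [mul_comm, h0] at h1
    exact absurd h1 hne
  · rw [← eq_of_hammingNorm_mul_eq (c := v * v') (d := u) (by rw [htr, h2, h0]), htr]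

theorem IsSaturated.petals_disjoint (hC : C.IsSaturated q) (hu4 : hammingNorm u = 4 * q)
    (hv : v ∈ lightFiber C q u h) (hv' : v' ∈ lightFiber C q u h) (hne : v ≠ v') :
    v * (1 + u) * (v' * (1 + u)) = 0 := by
  have h1 := hC.mul_eq_of_mem_lightFiber hu4 hv hv' hne
  obtain ⟨_, rfl⟩ := mem_lightFiber.1 hv
  calc v * (1 + u) * (v' * (1 + u)) = (v * v') * ((1 + u) * (1 + u)) := by ring
    _ = v * (u + u * u) := by rw [h1, word_mul_self]; ring
    _ = 0 := by rw [word_mul_self, word_add_self, mul_zero]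

theorem IsSaturated.hammingNorm_petal (hC : C.IsSaturated q) (hu4 : hammingNorm u = 4 * q)
    (hv : v ∈ lightNeighbors C q u) : hammingNorm (v * (1 + u)) = 2 * q := by
  have h1 := hammingNorm_mul_add_mul_compl v u
  have h2 := hC.trace_lightNeighbor hu4 hv
  rw [mul_comm] at h2
  have h3 := (mem_lightNeighbors.1 hv).2.1
  omega

theorem IsSaturated.sum_petals (hC : C.IsSaturated q) (hu4 : hammingNorm u = 4 * q)
    (h w : ι → ZMod 2) :
    ∑ v ∈ lightFiber C q u h, hammingNorm (w * (v * (1 + u))) ≤ hammingNorm (w * (1 + u)) := by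
  rw [sum_hammingNorm_mul _ (fun v => v * (1 + u)) fun v hv v' hv' hne =>
    hC.petals_disjoint hu4 hv hv' hne, ← Finset.sum_mul]
  rw [show w * ((∑ i ∈ lightFiber C q u h, i) * (1 + u)) =
    w * (1 + u) * (∑ i ∈ lightFiber C q u h, i) by ring]
  exact hammingNorm_mul_le_left _ _

theorem IsSaturated.card_lightFiber_le_six (hC : C.IsSaturated q) (hu4 : hammingNorm u = 4 * q)
    (h : ι → ZMod 2) : (lightFiber C q u h).card ≤ 6 := by
  have h1 := hC.sum_petals hu4 h 1
  rw [Finset.sum_congr rfl fun v hv => by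
    rw [one_mul, hC.hammingNorm_petal hu4 (mem_lightFiber.1 hv).1], Finset.sum_const,
    smul_eq_mul, one_mul] at h1
  have h2 := hammingNorm_one_add u
  rw [hC.card] at h2
  have : (lightFiber C q u h).card * (2 * q) ≤ 6 * (2 * q) := by omega
  exact le_of_mul_le_mul_right this (by have := hC.pos; omega)

/-- Inside `u`, the traces of `v` and `w` are two halves that are neither equal nor complementary,
so they overlap in q positions. The whole intersection of `v` and `w` then has weight 2q, which
leaves q for the petal. -/
theorem IsSaturated.hammingNorm_mul_petal (hC : C.IsSaturated q) (hu : u ∈ C)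
    (hu4 : hammingNorm u = 4 * q) (hv : v ∈ lightFiber C q u h) (hw : w ∈ lightNeighbors C q u)
    (hwh : u * w ≠ h) (hwh' : u * w ≠ u + h) : hammingNorm (w * (v * (1 + u))) = q := by
  obtain ⟨hvN, rfl⟩ := mem_lightFiber.1 hv
  obtain ⟨hvC, hv4, _⟩ := mem_lightNeighbors.1 hvN
  obtain ⟨hwC, hw4, _⟩ := mem_lightNeighbors.1 hw
  have hpos := hC.pos
  have hv2 := hC.trace_lightNeighbor hu4 hvN
  have hw2 := hC.trace_lightNeighbor hu4 hw
  have hsum := hammingNorm_add_add_two_mul (u * v) (u * w)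
  have htr : u * v * (u * w) = w * v * u := by
    calc u * v * (u * w) = (u * u) * (v * w) := by ring
      _ = w * v * u := by rw [word_mul_self]; ring
  rw [← mul_add, htr] at hsum
  have hq : hammingNorm (w * v * u) = q := by
    rcases hC.trace_cases hu hu4 (C.add_mem hvC hwC) with h0 | h0 | h0
    · rw [mul_add] at h0
      exact absurd (eq_of_word_add_eq_zero h0).symm hwh
    · refine absurd ?_ hwh'
      rw [mul_add] at h0
      calc u * w = u * v + u * w + u * v := by
            rw [add_comm (u * v), add_assoc, word_add_self, add_zero]
        _ = u + u * v := by rw [h0]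
    · omega
  have h2 := hammingNorm_mul_add_mul_compl (w * v) u
  rw [mul_assoc w v (1 + u)] at h2
  rcases hC.trace_cases hwC hw4 hvC with h0 | h0 | h0
  · rw [h0, zero_mul, hammingNorm_zero] at hq
    omega
  · have h1 : v * w = v := eq_of_hammingNorm_mul_eq (by rw [mul_comm, h0, hw4, hv4])
    rw [mul_comm, h0] at h1
    rw [h1] at hwh
    exact absurd rfl hwh
  · omega

/-- Outside `u` the word `w` has only 2q ones, and each of the disjoint petals takes q of them. -/
theorem IsSaturated.card_lightFiber_le_two (hC : C.IsSaturated q) (hu : u ∈ C)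
    (hu4 : hammingNorm u = 4 * q) (hw : w ∈ lightNeighbors C q u)
    (hwh : u * w ≠ h) (hwh' : u * w ≠ u + h) : (lightFiber C q u h).card ≤ 2 := by
  have h1 := hC.sum_petals hu4 h w
  rw [Finset.sum_congr rfl fun v hv => hC.hammingNorm_mul_petal hu hu4 hv hw hwh hwh',
    Finset.sum_const, smul_eq_mul, hC.hammingNorm_petal hu4 hw] at h1
  exact le_of_mul_le_mul_right h1 hC.pos

/-- Either all fibers have at most two elements, or there are at most twelve light neighbors, in
the fibers of a half and of its complement. -/
theorem IsSaturated.lightFiber_dichotomy (hC : C.IsSaturated q) (hu : u ∈ C)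
    (hu4 : hammingNorm u = 4 * q) :
    (∀ h, (lightFiber C q u h).card ≤ 2) ∨
      ∃ h, (lightNeighbors C q u).card ≤
        (lightFiber C q u h).card + (lightFiber C q u (u + h)).card := by
  classical
  by_cases hall : ∀ h, (lightFiber C q u h).card ≤ 2
  · exact Or.inl hall
  · push Not at hall
    obtain ⟨h, hh⟩ := hall
    refine Or.inr ⟨h, ?_⟩
    refine le_trans (Finset.card_le_card fun w hw => ?_) (Finset.card_union_le _ _)
    rw [Finset.mem_union, mem_lightFiber, mem_lightFiber]
    by_contra! hcon
    have := hC.card_lightFiber_le_two hu hu4 hw (hcon.1 hw) (hcon.2 hw)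
    omega

theorem IsSaturated.card_lightNeighbors_le (hC : C.IsSaturated q) (hu : u ∈ C)
    (hu4 : hammingNorm u = 4 * q) : (lightNeighbors C q u).card + 4 ≤ 16 * q := by
  have hpos := hC.pos
  rcases hC.lightFiber_dichotomy hu hu4 with hall | ⟨h, hh⟩
  · rw [hC.card_lightNeighbors_eq_sum hu4]
    have := Finset.sum_le_card_nsmul (halves C u) _ 2 fun h _ => hall h
    rw [hC.card_halves hu hu4, smul_eq_mul] at this
    omega
  · have h1 := hC.card_lightFiber_le_six hu4 h
    have h2 := hC.card_lightFiber_le_six hu4 (u + h)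
    omega

theorem IsSaturated.card_words_le (hC : C.IsSaturated q) : (words C).card ≤ 256 * q ^ 2 := by
  have hpos := hC.pos
  by_cases hno : ∀ c ∈ C, hammingNorm c ≠ 4 * q
  · have := hC.card_words_le_of_no_light hno
    nlinarith
  · push Not at hno
    obtain ⟨u, hu, hu4⟩ := hno
    have h1 := hC.card_words_le_lightNeighbors hu hu4
    have h2 := hC.card_lightNeighbors_le hu hu4
    calc (words C).card ≤ 16 * q * (4 + (lightNeighbors C q u).card) := h1
      _ ≤ 16 * q * (16 * q) := Nat.mul_le_mul_left _ (by omega)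
      _ = 256 * q ^ 2 := by ring

theorem IsSaturated.exists_light (hC : C.IsSaturated q) (hcard : (words C).card = 256 * q ^ 2) :
    ∃ u ∈ C, hammingNorm u = 4 * q := by
  by_contra! hno
  have := hC.card_words_le_of_no_light hno
  have := hC.pos
  nlinarith

theorem IsSaturated.card_lightNeighbors (hC : C.IsSaturated q)
    (hcard : (words C).card = 256 * q ^ 2) (hu : u ∈ C)
    (hu4 : hammingNorm u = 4 * q) : (lightNeighbors C q u).card + 4 = 16 * q := by
  refine le_antisymm (hC.card_lightNeighbors_le hu hu4) ?_
  have h1 := hC.card_words_le_lightNeighbors hu hu4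
  rw [hcard] at h1
  have h2 : 16 * q * (16 * q) ≤ 16 * q * (4 + (lightNeighbors C q u).card) := by
    linarith
  have := le_of_mul_le_mul_left h2 (by have := hC.pos; omega)
  omega

/-- There are 16q - 4 light neighbors over 8q - 2 halves, which leaves no slack in the bound of two
per fiber. -/
theorem IsSaturated.card_lightFiber_eq_two (hC : C.IsSaturated q)
    (hcard : (words C).card = 256 * q ^ 2) (hu : u ∈ C)
    (hu4 : hammingNorm u = 4 * q) (hall : ∀ h, (lightFiber C q u h).card ≤ 2) :
    ∀ h ∈ halves C u, (lightFiber C q u h).card = 2 := by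
  have h1 := hC.card_lightNeighbors hcard hu hu4
  have hpos := hC.pos
  rw [hC.card_lightNeighbors_eq_sum hu4] at h1
  refine (Finset.sum_eq_sum_iff_of_le fun h _ => hall h).1 ?_
  rw [Finset.sum_const, hC.card_halves hu hu4, smul_eq_mul]
  omega

/-- If all fibers are pairs, then all light neighbors of `u` live on a common set of `8 * q`
positions. -/
theorem IsSaturated.exists_block (hC : C.IsSaturated q)
    (hcard : (words C).card = 256 * q ^ 2) (hu : u ∈ C)
    (hu4 : hammingNorm u = 4 * q) (hall : ∀ h, (lightFiber C q u h).card ≤ 2) :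
    ∃ p ∈ C, u * p = 0 ∧ hammingNorm p = 4 * q ∧
      ∀ w ∈ lightNeighbors C q u, w * (u + p) = w := by
  classical
  have hpos := hC.pos
  have htwo := hC.card_lightFiber_eq_two hcard hu hu4 hall
  have hne : (halves C u).Nonempty := by
    rw [← Finset.card_pos, hC.card_halves hu hu4]
    omega
  obtain ⟨h, hh⟩ := hne
  obtain ⟨v, v', hvv', hF⟩ := Finset.card_eq_two.1 (htwo h hh)
  have hv : v ∈ lightFiber C q u h := by simp [hF]
  have hv' : v' ∈ lightFiber C q u h := by simp [hF]
  obtain ⟨hvN, hvh⟩ := mem_lightFiber.1 hv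
  obtain ⟨hvN', hvh'⟩ := mem_lightFiber.1 hv'
  obtain ⟨hvC, hv4, _⟩ := mem_lightNeighbors.1 hvN
  obtain ⟨hvC', hv4', _⟩ := mem_lightNeighbors.1 hvN'
  have hprod := hC.mul_eq_of_mem_lightFiber hu4 hv hv' hvv'
  have hh2 : hammingNorm h = 2 * q := hvh ▸ hC.trace_lightNeighbor hu4 hvN
  have hup : u * (v + v') = 0 := by rw [mul_add, hvh, hvh', word_add_self]
  have hin : ∀ w ∈ lightFiber C q u h, w * (u + (v + v')) = w := by
    intro w hw
    rw [hF, Finset.mem_insert, Finset.mem_singleton] at hw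
    rcases hw with rfl | rfl
    · rw [mul_add, mul_add, hprod, word_mul_self, mul_comm, hvh, add_comm w, ← add_assoc,
        word_add_self, zero_add]
    · rw [mul_add, mul_add, mul_comm w v, hprod, word_mul_self, mul_comm, hvh', ← add_assoc,
        word_add_self, zero_add]
  -- The kernel `h` cancels in `v + v'`, leaving the union of the two petals.
  refine ⟨v + v', C.add_mem hvC hvC', hup, ?_, fun w hw => ?_⟩
  · have := hammingNorm_add_add_two_mul v v'
    rw [hprod] at this
    omega
  · by_cases hwh : u * w = h
    · exact hin w (mem_lightFiber.2 ⟨hw, hwh⟩)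
    · by_cases hwh' : u * w = u + h
      · obtain ⟨hwC, hw4, hwu4⟩ := mem_lightNeighbors.1 hw
        have h1 : w + u ∈ lightFiber C q u h := by
          refine mem_lightFiber.2 ⟨mem_lightNeighbors.2 ⟨C.add_mem hwC hu, hwu4, ?_⟩, ?_⟩
          · rw [add_assoc, word_add_self, add_zero, hw4]
          · rw [mul_add, hwh', word_mul_self, add_comm u h, add_assoc, word_add_self, add_zero]
        have h2 := hin _ h1
        have h3 : u * (u + (v + v')) = u := by rw [mul_add, hup, word_mul_self, add_zero]
        rw [add_mul, h3] at h2
        exact add_right_cancel h2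
      -- Here `w` has 2q ones in `u` and q in each of the two petals, which accounts for its full
      -- weight 4q.
      · have h1 := hammingNorm_mul_add_mul_compl w u
        have h2 := sum_hammingNorm_mul (lightFiber C q u h) (fun v => v * (1 + u))
          (fun v hv v' hv' hne => hC.petals_disjoint hu4 hv hv' hne) w
        rw [Finset.sum_congr rfl fun v hv => hC.hammingNorm_mul_petal hu hu4 hv hw hwh hwh',
          Finset.sum_const, smul_eq_mul, htwo h hh, ← Finset.sum_mul, hF,
          Finset.sum_pair hvv'] at h2
        have h3 : (v + v') * (1 + u) = v + v' := by
          rw [mul_add, mul_one, mul_comm _ u, hup, add_zero]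
        rw [h3] at h2
        have h4 := hC.trace_lightNeighbor hu4 hw
        have h5 := (mem_lightNeighbors.1 hw).2.1
        refine eq_of_hammingNorm_mul_eq ?_
        rw [mul_add, hammingNorm_add_of_mul_eq_zero, ← h2, mul_comm w u]
        · omega
        · rw [mul_mul_mul_comm, hup, mul_zero]

end Fibers

/-! ### Splitting the code along a block of half the length -/

section Splitting

variable {ι : Type} [Fintype ι] {C : BinaryCode ι} {q : ℕ} {u p g : ι → ZMod 2}

/-- The codewords vanishing outside `g`. -/
noncomputable def supportedWords (C : BinaryCode ι) (g : ι → ZMod 2) : Finset (ι → ZMod 2) :=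
  (words C).filter fun c => c * g = c

theorem mem_supportedWords {c : ι → ZMod 2} : c ∈ supportedWords C g ↔ c ∈ C ∧ c * g = c := by
  simp [supportedWords]

/-- The 16q - 4 light neighbors live on the block, and so do the four further words 0, u, p, u + p.
-/
theorem IsSaturated.card_supportedWords (hC : C.IsSaturated q)
    (hcard : (words C).card = 256 * q ^ 2) (hu : u ∈ C) (hu4 : hammingNorm u = 4 * q)
    (hp : p ∈ C) (hup : u * p = 0) (hp4 : hammingNorm p = 4 * q)
    (hN : ∀ w ∈ lightNeighbors C q u, w * (u + p) = w) :
    16 * q ≤ (supportedWords C (u + p)).card := by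
  classical
  have hpos := hC.pos
  have hN4 := hC.card_lightNeighbors hcard hu hu4
  have hu0 := hC.ne_zero hu4
  have hp0 := hC.ne_zero hp4
  have hup' : u ≠ p := by
    rintro rfl
    rw [word_mul_self] at hup
    exact hu0 hup
  have h4 : ({0, u, p, u + p} : Finset (ι → ZMod 2)).card = 4 := by
    rw [Finset.card_insert_of_notMem, Finset.card_insert_of_notMem, Finset.card_pair]
    · simpa using hu0
    · simpa using ⟨hup', hp0⟩
    · simp only [Finset.mem_insert, Finset.mem_singleton, not_or]
      exact ⟨hu0.symm, hp0.symm, fun h => hup' (eq_of_word_add_eq_zero h.symm)⟩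
  have hdisj : Disjoint (lightNeighbors C q u) {0, u, p, u + p} := by
    rw [Finset.disjoint_left]
    intro w hw hw'
    have h2 := hC.trace_lightNeighbor hu4 hw
    simp only [Finset.mem_insert, Finset.mem_singleton] at hw'
    rcases hw' with rfl | rfl | rfl | rfl
    · rw [mul_zero, hammingNorm_zero] at h2
      omega
    · rw [word_mul_self] at h2
      omega
    · rw [hup, hammingNorm_zero] at h2
      omega
    · rw [mul_add, hup, word_mul_self, add_zero] at h2
      omega
  have hsub : lightNeighbors C q u ∪ {0, u, p, u + p} ⊆ supportedWords C (u + p) := by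
    intro w hw
    rw [mem_supportedWords]
    rcases Finset.mem_union.1 hw with hw | hw
    · exact ⟨(mem_lightNeighbors.1 hw).1, hN w hw⟩
    · simp only [Finset.mem_insert, Finset.mem_singleton] at hw
      rcases hw with rfl | rfl | rfl | rfl
      · exact ⟨C.zero_mem, zero_mul _⟩
      · exact ⟨hu, by rw [mul_add, hup, word_mul_self, add_zero]⟩
      · exact ⟨hp, by rw [mul_add, mul_comm, hup, word_mul_self, zero_add]⟩
      · exact ⟨C.add_mem hu hp, word_mul_self _⟩
  have := Finset.card_le_card hsub
  rw [Finset.card_union_of_disjoint hdisj, h4] at this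
  omega

/-- Each fiber of the restriction to the complement of `g` contains a translate of the subcode
supported on `g`. -/
theorem card_supportedWords_mul_card_trace_le :
    (supportedWords C g).card * (words (trace C (1 + g))).card ≤ (words C).card := by
  classical
  have himg : words (trace C (1 + g)) = (words C).image fun c => (1 + g) * c := by
    ext d
    simp [mem_trace]
  rw [himg]
  refine Finset.mul_card_image_le_card _ _ fun d hd => ?_
  obtain ⟨c, hc, rfl⟩ := Finset.mem_image.1 hd
  refine Finset.card_le_card_of_injOn (fun t => c + t) (fun t ht => ?_) fun x _ y _ hxy =>
    add_left_cancel hxy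
  obtain ⟨htC, htg⟩ := mem_supportedWords.1 ht
  rw [Finset.mem_coe, Finset.mem_filter]
  refine ⟨mem_words.2 (C.add_mem (mem_words.1 hc) htC), ?_⟩
  have : (1 + g) * t = 0 := by rw [add_mul, one_mul, mul_comm, htg, word_add_self]
  rw [mul_add, this, add_zero]

/-- Many words supported on `g` leave few traces on the complement, so these are balanced by the
second moment. Their weights are then divisible by 4q, hence so are the weights of the traces on
`g`, which makes that side balanced too. Counting shows that every trace on `g` is already a
codeword. -/
theorem IsSaturated.balanced_split (hC : C.IsSaturated q)
    (hcard : (words C).card = 256 * q ^ 2) (hg : g ∈ C) (hg8 : hammingNorm g = 8 * q)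
    (hT : 16 * q ≤ (supportedWords C g).card) :
    (∀ c ∈ C, g * c ∈ C) ∧ (words (trace C g)).card = 16 * q ∧
      (words (trace C (1 + g))).card = 16 * q := by
  have hpos := hC.pos
  have hg8' : hammingNorm (1 + g) = 8 * q := by
    have := hammingNorm_one_add g
    rw [hC.card] at this
    omega
  have ne_zero_of : ∀ {d : ι → ZMod 2}, hammingNorm d = 8 * q → d ≠ 0 := by
    rintro d hd rfl
    rw [hammingNorm_zero] at hd
    omega
  have hmem : ∀ {d : ι → ZMod 2}, d ∈ C → d ∈ trace C d := fun {d} hd =>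
    mem_trace.2 ⟨d, hd, word_mul_self d⟩
  have hg' : 1 + g ∈ C := C.add_mem hC.one_mem hg
  have hle : (words (trace C (1 + g))).card ≤ 2 * hammingNorm (1 + g) := by
    have h1 := (Nat.mul_le_mul_right _ hT).trans
      (card_supportedWords_mul_card_trace_le (C := C) (g := g))
    rw [hcard] at h1
    have h2 : 16 * q * (words (trace C (1 + g))).card ≤ 16 * q * (16 * q) := by linarith
    have := le_of_mul_le_mul_left h2 (by omega)
    omega
  have hbal' := balanced_of_card_words_le (separates_trace hC.sep) (hmem hg') (ne_zero_of hg8')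
    (fun d hd => mul_eq_self_of_mem_trace hd) hle
  have hcard' := card_words_of_balanced (separates_trace hC.sep) (hmem hg') (ne_zero_of hg8')
    hbal'
  have hbal : ∀ d ∈ trace C g,
      d = 0 ∨ d = g ∨ (d * g = d ∧ 2 * hammingNorm d = hammingNorm g) := by
    intro d hd
    have hself := mul_eq_self_of_mem_trace hd
    obtain ⟨c, hc, rfl⟩ := mem_trace.1 hd
    have h1 := hammingNorm_mul_add_mul_compl c g
    have h2 : 4 * q ∣ hammingNorm (c * (1 + g)) := by
      rw [mul_comm c]
      rcases hbal' _ (mul_mem_trace (1 + g) hc) with h | h | ⟨_, h⟩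
      · rw [h, hammingNorm_zero]
        exact dvd_zero _
      · rw [h, hg8']
        exact ⟨2, by ring⟩
      · exact ⟨1, by omega⟩
    have h3 : 4 * q ∣ hammingNorm (g * c) := by
      rw [mul_comm g c]
      exact (Nat.dvd_add_left h2).1 (h1 ▸ hC.dvd c hc)
    obtain ⟨m, hm⟩ := h3
    have hle := hammingNorm_mul_le_left g c
    have hm2 : m ≤ 2 := by
      by_contra hcon
      have : 4 * q * 3 ≤ 4 * q * m := Nat.mul_le_mul_left _ (by omega)
      omega
    interval_cases m
    · exact Or.inl (hammingNorm_eq_zero.1 (by omega))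
    · exact Or.inr (Or.inr ⟨hself, by omega⟩)
    · exact Or.inr (Or.inl (eq_of_hammingNorm_mul_eq (by omega)))
  have hcardg := card_words_of_balanced (separates_trace hC.sep) (hmem hg) (ne_zero_of hg8) hbal
  have heq : supportedWords C g = words (trace C g) := by
    refine Finset.eq_of_subset_of_card_le (fun c hc => ?_) (by omega)
    obtain ⟨hcC, hcg⟩ := mem_supportedWords.1 hc
    exact mem_words.2 (mem_trace.2 ⟨c, hcC, by rw [mul_comm, hcg]⟩)
  refine ⟨fun c hc => ?_, by omega, by omega⟩
  have := mem_words.2 (mul_mem_trace g hc)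
  rw [← heq] at this
  exact (mem_supportedWords.1 this).1

end Splitting

/-! ### Recognizing Reed–Muller codes -/

section ReedMuller

variable {ι : Type} [Fintype ι]

/-- A code of dimension `k` separating the `2 ^ (k - 1)` positions of the support of one of its
words `g` is a first order Reed-Muller code on these positions. -/
theorem exists_reedMuller_coords {D : BinaryCode ι} {g : ι → ZMod 2} {k : ℕ} (hk : 1 ≤ k)
    (hg : g ∈ D) (hD : ∀ d ∈ D, d * g = d) (hsep : D.Separates g)
    (hcard : (words D).card = 2 ^ k) (hgk : hammingNorm g = 2 ^ (k - 1)) :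
    ∃ φ : ι → (Fin (k - 1) → ZMod 2), (∀ x y, g x = 1 → g y = 1 → φ x = φ y → x = y) ∧
      (∀ z, ∃ x, g x = 1 ∧ φ x = z) ∧
      ∀ f : (Fin (k - 1) → ZMod 2) → ZMod 2, f ∈ reedMuller k ↔ (g * fun x => f (φ x)) ∈ D := by
  classical
  have h01 : ∀ a : ZMod 2, a ≠ 0 → a = 1 := by decide
  have hg0 : g ≠ 0 := by
    rintro rfl
    rw [hammingNorm_zero] at hgk
    exact absurd hgk.symm (by positivity)
  obtain ⟨x₀, hx₀⟩ := Function.ne_iff.1 hg0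
  replace hx₀ : g x₀ = 1 := h01 _ hx₀
  have hfr : Module.finrank (ZMod 2) D = k := by
    rw [card_words] at hcard
    exact Nat.pow_right_injective le_rfl hcard
  -- The words vanishing at `x₀` form a complement of the line through `g`; a basis of them supplies
  -- the k - 1 coordinate functions, while `g` plays the all-one word.
  let D₀ : BinaryCode ι := D ⊓ LinearMap.ker (LinearMap.proj (R := ZMod 2) x₀)
  have hD₀ : ∀ d, d ∈ D₀ ↔ d ∈ D ∧ d x₀ = 0 := fun d => by simp [D₀]
  have hsup : D₀ ⊔ Submodule.span (ZMod 2) {g} = D := by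
    refine le_antisymm (sup_le inf_le_left (by simpa using hg)) fun d hd => ?_
    by_cases h : d x₀ = 0
    · exact Submodule.mem_sup_left ((hD₀ d).2 ⟨hd, h⟩)
    · rw [show d = (d + g) + g by rw [add_assoc, word_add_self, add_zero]]
      refine Submodule.add_mem_sup ((hD₀ _).2 ⟨D.add_mem hd hg, ?_⟩)
        (Submodule.mem_span_singleton_self g)
      rw [Pi.add_apply, h01 _ h, hx₀]
      decide
  have hinf : D₀ ⊓ Submodule.span (ZMod 2) {g} = ⊥ := by
    rw [eq_bot_iff]
    rintro d ⟨h1, h2⟩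
    obtain ⟨a, rfl⟩ := Submodule.mem_span_singleton.1 h2
    have h3 := ((hD₀ _).1 h1).2
    rw [Pi.smul_apply, hx₀, smul_eq_mul, mul_one] at h3
    rw [h3, zero_smul]
    exact Submodule.zero_mem _
  have hfr₀ : Module.finrank (ZMod 2) D₀ = k - 1 := by
    have := Submodule.finrank_sup_add_finrank_inf_eq D₀ (Submodule.span (ZMod 2) {g})
    rw [hsup, hinf, finrank_bot, finrank_span_singleton hg0, hfr] at this
    omega
  let b := Module.finBasisOfFinrankEq (ZMod 2) D₀ hfr₀
  have hspan : Submodule.span (ZMod 2) (Set.range fun i => (b i : ι → ZMod 2)) = D₀ := by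
    have h1 := congrArg (Submodule.map D₀.subtype) b.span_eq
    rw [Submodule.map_span, Submodule.map_top, Submodule.range_subtype, ← Set.range_comp] at h1
    exact h1
  have hspan' : Submodule.span (ZMod 2)
      ((Set.range fun i => (b i : ι → ZMod 2)) ∪ {g}) = D := by
    rw [Submodule.span_union, hspan, hsup]
  let φ : ι → (Fin (k - 1) → ZMod 2) := fun x i => (b i : ι → ZMod 2) x
  have hinj : ∀ x y, g x = 1 → g y = 1 → φ x = φ y → x = y := by
    intro x y hx hy hxy
    refine hsep x y hx hy fun c hc => ?_
    rw [← hspan'] at hc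
    induction hc using Submodule.span_induction with
    | mem c hc =>
      rcases hc with ⟨i, rfl⟩ | rfl
      · exact congrFun hxy i
      · rw [hx, hy]
    | zero => rfl
    | add c d _ _ hc hd => rw [Pi.add_apply, Pi.add_apply, hc, hd]
    | smul a c _ hc => rw [Pi.smul_apply, Pi.smul_apply, hc]
  have hsurj : ∀ z, ∃ x, g x = 1 ∧ φ x = z := by
    -- Separation makes `φ` injective on the support of `g`, which has exactly as many positions as
    -- there are vectors.
    have himg : (Finset.univ.filter fun x => g x ≠ 0).image φ = Finset.univ := by
      refine Finset.eq_univ_of_card _ ?_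
      rw [Finset.card_image_of_injOn]
      · rw [Fintype.card_fun, Fintype.card_fin, ZMod.card]
        exact hgk
      · intro x hx y hy hxy
        simp only [Finset.coe_filter, Finset.mem_univ, true_and, Set.mem_ofPred_eq] at hx hy
        exact hinj x y (h01 _ hx) (h01 _ hy) hxy
    intro z
    obtain ⟨x, hx, hxz⟩ := Finset.mem_image.1 (himg.symm ▸ Finset.mem_univ z)
    exact ⟨x, h01 _ (Finset.mem_filter.1 hx).2, hxz⟩
  refine ⟨φ, hinj, hsurj, fun f => ?_⟩
  let L : ((Fin (k - 1) → ZMod 2) → ZMod 2) →ₗ[ZMod 2] (ι → ZMod 2) :=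
    LinearMap.mulLeft (ZMod 2) g ∘ₗ LinearMap.funLeft (ZMod 2) (ZMod 2) φ
  have hLapp : ∀ f, L f = g * fun x => f (φ x) := fun f => rfl
  have hLinj : Function.Injective L := by
    intro f₁ f₂ hf
    funext z
    obtain ⟨x, hx, rfl⟩ := hsurj z
    have := congrFun hf x
    rwa [hLapp, hLapp, Pi.mul_apply, Pi.mul_apply, hx, one_mul, one_mul] at this
  have hmap : (reedMuller k).map L = D := by
    rw [reedMuller, Submodule.map_span, Set.image_union, Set.image_singleton, ← Set.range_comp,
      ← hspan']
    congr 2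
    · refine congrArg Set.range (funext fun i => ?_)
      rw [Function.comp_apply, hLapp, mul_comm]
      exact hD _ ((hD₀ _).1 (b i).2).1
    · rw [hLapp]
      exact congrArg _ (mul_one g)
  rw [← hLapp, ← hmap]
  exact ⟨Submodule.mem_map_of_mem, fun ⟨f', hf', he⟩ => hLinj he ▸ hf'⟩

/-- Closure under multiplication by `g` makes `C` the direct sum of its traces on `g` and on the
complement, and each trace code is a Reed–Muller code by its parameters. -/
theorem iso_reedMuller_directSum {C : BinaryCode ι} {g : ι → ZMod 2} {k : ℕ} (hk : 1 ≤ k)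
    (h1 : 1 ∈ C) (hg : g ∈ C) (hsep : C.Separates 1) (hmul : ∀ c ∈ C, g * c ∈ C)
    (hgk : hammingNorm g = 2 ^ (k - 1)) (hgk' : hammingNorm (1 + g) = 2 ^ (k - 1))
    (hcard : (words (trace C g)).card = 2 ^ k)
    (hcard' : (words (trace C (1 + g))).card = 2 ^ k) :
    C.Iso ((reedMuller k).directSum (reedMuller k)) := by
  classical
  have hmem : ∀ {d : ι → ZMod 2}, d ∈ C → d ∈ trace C d := fun {d} hd =>
    mem_trace.2 ⟨d, hd, word_mul_self d⟩
  obtain ⟨φ, hinj, hsurj, hφ⟩ := exists_reedMuller_coords hk (hmem hg)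
    (fun d hd => mul_eq_self_of_mem_trace hd) (separates_trace hsep) hcard hgk
  obtain ⟨ψ, hinj', hsurj', hψ⟩ := exists_reedMuller_coords hk (hmem (C.add_mem h1 hg))
    (fun d hd => mul_eq_self_of_mem_trace hd) (separates_trace hsep) hcard' hgk'
  have hcompl : ∀ x, (1 + g) x = 1 ↔ g x ≠ 1 := by
    have : ∀ a : ZMod 2, 1 + a = 1 ↔ a ≠ 1 := by decide
    exact fun x => this (g x)
  let e₀ : ι → (Fin (k - 1) → ZMod 2) ⊕ (Fin (k - 1) → ZMod 2) := fun x =>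
    if g x = 1 then Sum.inl (φ x) else Sum.inr (ψ x)
  have hl : ∀ {x}, g x = 1 → e₀ x = Sum.inl (φ x) := fun hx => if_pos hx
  have hr : ∀ {x}, g x ≠ 1 → e₀ x = Sum.inr (ψ x) := fun hx => if_neg hx
  have hbij : Function.Bijective e₀ := by
    constructor
    · intro x y hxy
      by_cases hx : g x = 1 <;> by_cases hy : g y = 1
      · rw [hl hx, hl hy] at hxy
        exact hinj x y hx hy (Sum.inl_injective hxy)
      · rw [hl hx, hr hy] at hxy
        cases hxy
      · rw [hr hx, hl hy] at hxy
        cases hxy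
      · rw [hr hx, hr hy] at hxy
        exact hinj' x y ((hcompl x).2 hx) ((hcompl y).2 hy) (Sum.inr_injective hxy)
    · rintro (z | z)
      · obtain ⟨x, hx, rfl⟩ := hsurj z
        exact ⟨x, hl hx⟩
      · obtain ⟨x, hx, rfl⟩ := hsurj' z
        exact ⟨x, hr ((hcompl x).1 hx)⟩
  have htrace : ∀ d ∈ trace C g, d ∈ C := by
    intro d hd
    obtain ⟨c, hc, rfl⟩ := mem_trace.1 hd
    exact hmul c hc
  have htrace' : ∀ d ∈ trace C (1 + g), d ∈ C := by
    intro d hd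
    obtain ⟨c, hc, rfl⟩ := mem_trace.1 hd
    rw [add_mul, one_mul]
    exact C.add_mem hc (hmul c hc)
  refine ⟨Equiv.ofBijective e₀ hbij, fun d => ?_⟩
  have hleft : (g * fun x => d (Sum.inl (φ x))) = g * fun x => d (e₀ x) := by
    funext x
    by_cases hx : g x = 1
    · simp only [Pi.mul_apply, hl hx]
    · have : g x = 0 := by
        revert hx
        generalize g x = a
        revert a
        decide
      simp only [Pi.mul_apply, this, zero_mul]
  have hright : ((1 + g) * fun x => d (Sum.inr (ψ x))) = (1 + g) * fun x => d (e₀ x) := by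
    funext x
    by_cases hx : g x = 1
    · have : (1 + g) x = 0 := by
        rw [Pi.add_apply, Pi.one_apply, hx]
        decide
      simp only [Pi.mul_apply, this, zero_mul]
    · simp only [Pi.mul_apply, hr hx]
  have hiff : d ∈ (reedMuller k).directSum (reedMuller k) ↔
      (g * fun x => d (e₀ x)) ∈ trace C g ∧ ((1 + g) * fun x => d (e₀ x)) ∈ trace C (1 + g) := by
    rw [← hleft, ← hright]
    exact and_congr (hφ fun z => d (Sum.inl z)) (hψ fun z => d (Sum.inr z))
  refine hiff.trans ⟨fun ⟨ha, hb⟩ => ?_, fun h => ⟨mul_mem_trace g h, mul_mem_trace (1 + g) h⟩⟩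
  have := C.add_mem (htrace _ ha) (htrace' _ hb)
  rw [← add_mul, add_left_comm, word_add_self, add_zero, one_mul] at this
  exact this

end ReedMuller

/-! ### The exceptional code of length 16 -/

section DoubledParityCheck

variable {ι : Type} [Fintype ι] {C : BinaryCode ι}

/-- A word of weight two with ones at `x` and `y` picks the entries of `c` at `x` and `y`. -/
theorem hammingNorm_mul_of_two {b c : ι → ZMod 2} {x y : ι} (hb : hammingNorm b = 2)
    (hx : b x = 1) (hy : b y = 1) (hxy : x ≠ y) :
    hammingNorm (c * b) = (c x).val + (c y).val := by
  classical
  have hsupp : ({x, y} : Finset ι) = Finset.univ.filter fun i => b i ≠ 0 := by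
    refine Finset.eq_of_subset_of_card_le (fun z hz => ?_) ?_
    · rw [Finset.mem_filter]
      refine ⟨Finset.mem_univ z, ?_⟩
      rcases Finset.mem_insert.1 hz with rfl | hz
      · rw [hx]
        exact one_ne_zero
      · rw [Finset.mem_singleton.1 hz, hy]
        exact one_ne_zero
    · rw [Finset.card_pair hxy]
      exact hb.le
  rw [hammingNorm_eq_sum_val, ← Finset.sum_subset (Finset.subset_univ {x, y}),
    Finset.sum_pair hxy]
  · simp only [Pi.mul_apply, hx, hy, mul_one]
  · intro z _ hz
    rw [hsupp, Finset.mem_filter, not_and_not_right] at hz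
    simp [hz (Finset.mem_univ z)]

/-- A saturated code of length 16 whose positions fall into eight pairs, any two of which form a
codeword, is the extended double of the parity check code. -/
theorem IsSaturated.iso_extendedDoubleParityCheck (hC : C.IsSaturated 1)
    (b : Fin 8 → ι → ZMod 2) (hdisj : ∀ i j, i ≠ j → b i * b j = 0)
    (hb2 : ∀ i, hammingNorm (b i) = 2) (hbC : ∀ i, b 0 + b i ∈ C) :
    C.Iso extendedDoubleParityCheck := by
  classical
  have hparts : ∀ c : ι → ZMod 2, ∑ i, hammingNorm (c * b i) = hammingNorm (c * ∑ i, b i) :=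
    fun c => sum_hammingNorm_mul Finset.univ b (fun i _ j _ hij => hdisj i j hij) c
  have hone : ∑ i, b i = 1 := by
    refine eq_one_of_hammingNorm_eq_card ?_
    have := hparts 1
    simp only [one_mul, hb2, Finset.sum_const, Finset.card_univ, Fintype.card_fin] at this
    rw [← this, hC.card]
    rfl
  have hex : ∀ x, ∃ i, b i x = 1 := by
    intro x
    by_contra! hcon
    have h01 : ∀ a : ZMod 2, a ≠ 1 → a = 0 := by decide
    have := congrFun hone x
    rw [Finset.sum_apply, Finset.sum_eq_zero fun i _ => h01 _ (hcon i)] at this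
    exact zero_ne_one this
  choose idx hidx using hex
  have huniq : ∀ i x, b i x = 1 → i = idx x := by
    intro i x hi
    by_contra hne
    have := congrFun (hdisj i (idx x) hne) x
    rw [Pi.mul_apply, hi, hidx, one_mul] at this
    exact one_ne_zero this
  have hb_apply : ∀ i x, b i x = if i = idx x then 1 else 0 := by
    intro i x
    split_ifs with h
    · rw [h, hidx]
    · have h01 : ∀ a : ZMod 2, a ≠ 1 → a = 0 := by decide
      exact h01 _ fun h' => h (huniq i x h')
  -- A codeword meets the codeword `b 0 + b i` in an even number of positions, so its parity is the
  -- same on all eight pairs.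
  have hpar : ∀ c ∈ C, ∀ i, hammingNorm (c * b i) % 2 = hammingNorm (c * b 0) % 2 := by
    intro c hc i
    by_cases hi : i = 0
    · rw [hi]
    · obtain ⟨m, hm⟩ := hC.dvd_mul hc (hbC i)
      rw [mul_add, hammingNorm_add_of_mul_eq_zero] at hm
      · omega
      · rw [mul_mul_mul_comm, hdisj 0 i (Ne.symm hi), mul_zero]
  have hpair : ∀ i, ∃ x y, x ≠ y ∧ b i x = 1 ∧ b i y = 1 := by
    intro i
    have h01 : ∀ a : ZMod 2, a ≠ 0 → a = 1 := by decide
    obtain ⟨x, y, hxy, hs⟩ := Finset.card_eq_two.1 (hb2 i)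
    have hx : x ∈ ({x, y} : Finset ι) := by simp
    have hy : y ∈ ({x, y} : Finset ι) := by simp
    rw [← hs] at hx hy
    exact ⟨x, y, hxy, h01 _ (Finset.mem_filter.1 hx).2, h01 _ (Finset.mem_filter.1 hy).2⟩
  have heven : ∀ c, ∀ i x y, hammingNorm (c * b i) % 2 = 0 → b i x = 1 → b i y = 1 →
      c x = c y := by
    intro c i x y hc hx hy
    by_cases hxy : x = y
    · rw [hxy]
    · have key : ∀ s t : ZMod 2, (s.val + t.val) % 2 = 0 → s = t := by decide
      rw [hammingNorm_mul_of_two (hb2 i) hx hy hxy] at hc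
      exact key _ _ hc
  -- If every codeword were even on `b 0`, the two positions of that pair would not be separated.
  have hodd : ∃ c ∈ C, hammingNorm (c * b 0) % 2 = 1 := by
    by_contra! hcon
    obtain ⟨x, y, hxy, hx, hy⟩ := hpair 0
    refine hxy (hC.sep x y rfl rfl fun c hc => heven c 0 x y ?_ hx hy)
    have := hcon c hc
    omega
  obtain ⟨c₀, hc₀, hc₀odd⟩ := hodd
  -- The word `c₀` contains exactly one position of each pair; these positions form the first copy,
  -- so `c₀` becomes `halfOnes`.
  let e₀ : ι → Fin 2 × Fin 8 := fun x => (if c₀ x = 1 then 0 else 1, idx x)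
  have hinj : Function.Injective e₀ := by
    intro x y hxy
    by_contra hne
    obtain ⟨h1, h2⟩ := Prod.ext_iff.1 hxy
    have h3 := hpar c₀ hc₀ (idx x)
    rw [hammingNorm_mul_of_two (hb2 _) (hidx x) (by rw [show idx x = idx y from h2, hidx]) hne,
      hc₀odd] at h3
    have key : ∀ s t : ZMod 2, (if s = 1 then (0 : Fin 2) else 1) = (if t = 1 then 0 else 1) →
        (s.val + t.val) % 2 ≠ 1 := by decide
    exact key _ _ h1 h3
  have hbij : Function.Bijective e₀ := by
    refine (Fintype.bijective_iff_injective_and_card e₀).2 ⟨hinj, ?_⟩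
    rw [hC.card]
    rfl
  have hhalf : (fun x => halfOnes (e₀ x)) = c₀ := by
    funext x
    have key : ∀ s : ZMod 2,
        (if (if s = 1 then (0 : Fin 2) else 1) = 0 then (1 : ZMod 2) else 0) = s := by decide
    exact key (c₀ x)
  let E := Equiv.ofBijective e₀ hbij
  let P : (Fin 2 × Fin 8 → ZMod 2) →ₗ[ZMod 2] (ι → ZMod 2) :=
    LinearMap.funLeft (ZMod 2) (ZMod 2) e₀
  have hforward : extendedDoubleParityCheck ≤ C.comap P := by
    refine sup_le ?_ ?_
    · rintro _ ⟨c, hc, rfl⟩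
      replace hc : ∑ i, c i = 0 := hc
      -- The entries of `c` sum to zero, so the contributions of `b 0` cancel and the doubled word
      -- is a combination of known codewords.
      have hrw : P (LinearMap.funLeft (ZMod 2) (ZMod 2) Prod.snd c) =
          ∑ i, c i • (b 0 + b i) := by
        simp only [smul_add, Finset.sum_add_distrib]
        rw [← Finset.sum_smul, hc, zero_smul, zero_add]
        funext x
        simp only [Finset.sum_apply, Pi.smul_apply, hb_apply, smul_eq_mul, mul_ite, mul_one,
          mul_zero, Finset.sum_ite_eq', Finset.mem_univ, if_true]
        rfl
      rw [Submodule.mem_comap, hrw]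
      exact C.sum_mem fun i _ => C.smul_mem _ (hbC i)
    · rw [Submodule.span_singleton_le_iff_mem, Submodule.mem_comap]
      exact (congrArg (· ∈ C) hhalf).mpr hc₀
  have hbackward_even : ∀ d, P d ∈ C → hammingNorm (P d * b 0) % 2 = 0 →
      d ∈ extendedDoubleParityCheck := by
    intro d hd hd0
    refine Submodule.mem_sup_left ⟨fun i => d (0, i), ?_, ?_⟩
    · have hblock : ∀ i, hammingNorm (P d * b i) = 2 * (d (0, i)).val := by
        intro i
        obtain ⟨x, y, hxy, hx, hy⟩ := hpair i
        obtain ⟨z, hz⟩ := hbij.2 (0, i)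
        have hzi : b i z = 1 := by
          rw [hb_apply, if_pos]
          exact (congrArg Prod.snd hz).symm
        have hz' : P d z = d (0, i) := congrArg d hz
        have he := (hpar _ hd i).trans hd0
        rw [hammingNorm_mul_of_two (hb2 i) hx hy hxy, heven _ i x z he hx hzi,
          heven _ i y z he hy hzi, hz']
        ring
      have hsum := hparts (P d)
      rw [hone, mul_one, Finset.sum_congr rfl fun i _ => hblock i, ← Finset.mul_sum] at hsum
      obtain ⟨m, hm⟩ := hC.dvd _ hd
      -- The weight is twice the number of full pairs and divisible by 4, so that number is even:
      -- this is the parity check.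
      have hm' : ∑ i : Fin 8, (d (0, i)).val = 2 * m := by omega
      change ∑ i : Fin 8, d (0, i) = 0
      have hcast : ((∑ i : Fin 8, (d (0, i)).val : ℕ) : ZMod 2) = ∑ i : Fin 8, d (0, i) := by
        rw [Nat.cast_sum]
        exact Finset.sum_congr rfl fun i _ => ZMod.natCast_zmod_val _
      rw [← hcast, hm', Nat.cast_mul]
      exact mul_eq_zero_of_left (by decide) _
    · funext ⟨r, i⟩
      obtain ⟨x, hx⟩ := hbij.2 (r, i)
      obtain ⟨z, hz⟩ := hbij.2 (0, i)
      have hbx : b i x = 1 := by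
        rw [hb_apply, if_pos]
        exact (congrArg Prod.snd hx).symm
      have hbz : b i z = 1 := by
        rw [hb_apply, if_pos]
        exact (congrArg Prod.snd hz).symm
      have h1 := heven (P d) i z x ((hpar _ hd i).trans hd0) hbz hbx
      have h2 : P d z = d (0, i) := congrArg d hz
      have h3 : P d x = d (r, i) := congrArg d hx
      rw [h2, h3] at h1
      exact h1
  refine ⟨E, fun d => ⟨fun h => hforward h, fun h => ?_⟩⟩
  replace h : P d ∈ C := h
  -- A word that is even on the pairs is constant on each of them, hence doubled; an odd one becomes
  -- even after adding `c₀`.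
  rcases Nat.mod_two_eq_zero_or_one (hammingNorm (P d * b 0)) with h0 | h0
  · exact hbackward_even d h h0
  · have hhalf' : P halfOnes = c₀ := hhalf
    have hmem : d + halfOnes ∈ extendedDoubleParityCheck := by
      refine hbackward_even _ ?_ ?_
      · rw [map_add, hhalf']
        exact C.add_mem h hc₀
      · rw [map_add, hhalf', add_mul]
        have := hammingNorm_add_add_two_mul (P d * b 0) (c₀ * b 0)
        omega
    have := Submodule.add_mem _ hmem
      (Submodule.mem_sup_right (Submodule.mem_span_singleton_self halfOnes))
    rwa [add_assoc, word_add_self, add_zero] at this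

/-- A fiber with six elements yields eight pairs of positions. -/
theorem IsSaturated.iso_of_card_lightFiber (hC : C.IsSaturated 1) {u h : ι → ZMod 2} (hu : u ∈ C)
    (hu4 : hammingNorm u = 4 * 1) (hF : (lightFiber C 1 u h).card = 6) :
    C.Iso extendedDoubleParityCheck := by
  classical
  let σ := (Finset.equivFinOfCardEq hF).symm
  have hσF : ∀ j, (σ j : ι → ZMod 2) ∈ lightFiber C 1 u h := fun j => (σ j).2
  have hσN : ∀ j, (σ j : ι → ZMod 2) ∈ lightNeighbors C 1 u := fun j =>
    (mem_lightFiber.1 (hσF j)).1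
  have hσh : ∀ j, u * (σ j : ι → ZMod 2) = h := fun j => (mem_lightFiber.1 (hσF j)).2
  have huh : u * h = h := by rw [← hσh 0, ← mul_assoc, word_mul_self]
  have hh2 : hammingNorm h = 2 := by
    rw [← hσh 0]
    exact hC.trace_lightNeighbor hu4 (hσN 0)
  have hcompl : (1 + u) * h = 0 := by rw [add_mul, one_mul, huh, word_add_self]
  have hcompl' : u * (1 + u) = 0 := by rw [mul_add, mul_one, word_mul_self, word_add_self]
  -- The eight pairs are the kernel `h`, its complement in `u`, and the six petals. Joining `h` to
  -- them gives `u` and the six light neighbors.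
  let b : Fin 8 → ι → ZMod 2 :=
    Fin.cons h (Fin.cons (u + h) fun j : Fin 6 => (σ j : ι → ZMod 2) * (1 + u))
  have h01 : h * (u + h) = 0 := by rw [mul_add, mul_comm, huh, word_mul_self, word_add_self]
  have h0j : ∀ v : ι → ZMod 2, h * (v * (1 + u)) = 0 := fun v => by
    rw [show h * (v * (1 + u)) = v * ((1 + u) * h) by ring, hcompl, mul_zero]
  have h1j : ∀ v : ι → ZMod 2, (u + h) * (v * (1 + u)) = 0 := fun v => by
    rw [add_mul, h0j, add_zero, show u * (v * (1 + u)) = v * (u * (1 + u)) by ring, hcompl',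
      mul_zero]
  refine hC.iso_extendedDoubleParityCheck b ?_ ?_ ?_
  · intro i j hij
    induction i using Fin.cases with
    | zero =>
      induction j using Fin.cases with
      | zero => exact absurd rfl hij
      | succ j =>
        induction j using Fin.cases with
        | zero => exact h01
        | succ j => exact h0j _
    | succ i =>
      induction i using Fin.cases with
      | zero =>
        induction j using Fin.cases with
        | zero => exact (mul_comm _ _).trans h01
        | succ j =>
          induction j using Fin.cases with
          | zero => exact absurd rfl hij
          | succ j => exact h1j _
      | succ i =>
        induction j using Fin.cases with
        | zero => exact (mul_comm _ _).trans (h0j _)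
        | succ j =>
          induction j using Fin.cases with
          | zero => exact (mul_comm _ _).trans (h1j _)
          | succ j =>
            refine hC.petals_disjoint hu4 (hσF i) (hσF j) fun h => hij ?_
            exact congrArg (fun k : Fin 6 => k.succ.succ) (σ.injective (Subtype.ext h))
  · intro i
    induction i using Fin.cases with
    | zero => exact hh2
    | succ i =>
      induction i using Fin.cases with
      | zero =>
        have h1 := hammingNorm_add_add_two_mul u h
        rw [huh, hh2, hu4] at h1
        change hammingNorm (u + h) = 2
        omega
      | succ i => exact hC.hammingNorm_petal hu4 (hσN i)
  · intro i
    induction i using Fin.cases with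
    | zero =>
      rw [word_add_self]
      exact C.zero_mem
    | succ i =>
      induction i using Fin.cases with
      | zero =>
        change h + (u + h) ∈ C
        rwa [add_left_comm, word_add_self, add_zero]
      | succ i =>
        change h + (σ i : ι → ZMod 2) * (1 + u) ∈ C
        rw [mul_add, mul_one, mul_comm _ u, hσh, add_left_comm, word_add_self, add_zero]
        exact (mem_lightNeighbors.1 (hσN i)).1

end DoubledParityCheck

/-! ### Classification and reduction to saturated codes -/

section Classification

variable {ι : Type} [Fintype ι] {C : BinaryCode ι}

theorem IsSaturated.classification {a : ℕ} (ha : 2 ≤ a) (hC : C.IsSaturated (2 ^ (a - 2)))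
    (hcard : (words C).card = 256 * (2 ^ (a - 2)) ^ 2) :
    C.Iso ((reedMuller (a + 2)).directSum (reedMuller (a + 2))) ∨
      (a = 2 ∧ C.Iso extendedDoubleParityCheck) := by
  obtain ⟨m, rfl⟩ := Nat.exists_eq_add_of_le' ha
  rw [Nat.add_sub_cancel] at hC hcard
  obtain ⟨u, hu, hu4⟩ := hC.exists_light hcard
  rcases hC.lightFiber_dichotomy hu hu4 with hall | ⟨h, hh⟩
  · left
    obtain ⟨p, hp, hup, hp4, hN⟩ := hC.exists_block hcard hu hu4 hall
    have hg8 : hammingNorm (u + p) = 8 * 2 ^ m := by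
      rw [hammingNorm_add_of_mul_eq_zero hup]
      omega
    have hg8' : hammingNorm (1 + (u + p)) = 8 * 2 ^ m := by
      have := hammingNorm_one_add (u + p)
      rw [hC.card] at this
      omega
    have hg := C.add_mem hu hp
    obtain ⟨h1, h2, h3⟩ := hC.balanced_split hcard hg hg8
      (hC.card_supportedWords hcard hu hu4 hp hup hp4 hN)
    have e1 : 8 * 2 ^ m = 2 ^ (m + 2 + 2 - 1) := by
      rw [show m + 2 + 2 - 1 = m + 3 from rfl, pow_add]
      ring
    have e2 : 16 * 2 ^ m = 2 ^ (m + 2 + 2) := by ring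
    exact iso_reedMuller_directSum (by omega) hC.one_mem hg hC.sep h1 (hg8.trans e1)
      (hg8'.trans e1) (h2.trans e2) (h3.trans e2)
  · right
    have h1 := hC.card_lightFiber_le_six hu4 h
    have h2 := hC.card_lightFiber_le_six hu4 (u + h)
    have h3 := hC.card_lightNeighbors hcard hu hu4
    -- Two fibers hold at most 12 light neighbors, whereas 16q - 4 of them exist; hence q = 1 and
    -- both fibers have six elements.
    have hm : m = 0 := by
      by_contra hm
      have : 2 ^ 1 ≤ 2 ^ m := Nat.pow_le_pow_right (by norm_num) (by omega)
      omega
    subst hm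
    exact ⟨rfl, IsSaturated.iso_of_card_lightFiber hC (h := h) hu hu4
      (show (lightFiber C (2 ^ 0) u h).card = 6 by omega)⟩

/-- Adjoining the all-one word to a projective divisible code. -/
theorem isSaturated_sup_one {a : ℕ} (ha : 2 ≤ a) (hcard : Fintype.card ι = 4 * 2 ^ a)
    (hproj : C.IsProjective) (hdiv : C.IsDivisible (2 ^ a)) :
    (C ⊔ Submodule.span (ZMod 2) {1}).IsSaturated (2 ^ (a - 2)) := by
  have h4 : 2 ^ a = 4 * 2 ^ (a - 2) := by
    obtain ⟨m, rfl⟩ := Nat.exists_eq_add_of_le' ha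
    rw [Nat.add_sub_cancel, pow_add]
    ring
  refine ⟨by positivity, by omega,
    Submodule.mem_sup_right (Submodule.mem_span_singleton_self 1), fun d hd => ?_,
    fun x y _ _ hxy => hproj.2 x y fun c hc => hxy c (Submodule.mem_sup_left hc)⟩
  obtain ⟨c, hc, e, he, rfl⟩ := Submodule.mem_sup.1 hd
  obtain ⟨r, rfl⟩ := Submodule.mem_span_singleton.1 he
  rw [← h4]
  have h01 : ∀ s : ZMod 2, s = 0 ∨ s = 1 := by decide
  rcases h01 r with rfl | rfl
  · rw [zero_smul, add_zero]
    exact hdiv c hc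
  · rw [one_smul, add_comm]
    refine (Nat.dvd_add_right (hdiv c hc)).1 ?_
    rw [hammingNorm_one_add, hcard]
    exact Dvd.intro_left 4 rfl

end Classification

end BinaryCode

theorem mainTheorem4 (a Δ k : ℕ) (ha : 2 ≤ a) (hΔ : Δ = 2 ^ a)
    (C : BinaryCode (Fin (4 * Δ))) (hk : Module.finrank (ZMod 2) C = k)
    (hproj : C.IsProjective) (hdiv : C.IsDivisible Δ) :
    k ≤ 2 * a + 4 ∧
      (k = 2 * a + 4 →
        C.Iso ((BinaryCode.reedMuller (a + 2)).directSum (BinaryCode.reedMuller (a + 2))) ∨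
        (a = 2 ∧ C.Iso BinaryCode.extendedDoubleParityCheck)) := by
  subst hΔ hk
  have hsat := BinaryCode.isSaturated_sup_one ha (Fintype.card_fin _) hproj hdiv
  have hpow : 256 * (2 ^ (a - 2)) ^ 2 = 2 ^ (2 * a + 4) := by
    obtain ⟨m, rfl⟩ := Nat.exists_eq_add_of_le' ha
    rw [Nat.add_sub_cancel]
    ring
  have hle : C ≤ C ⊔ Submodule.span (ZMod 2) {1} := le_sup_left
  have hbound := hsat.card_words_le
  rw [hpow, BinaryCode.card_words] at hbound
  have hk' := (Nat.pow_le_pow_iff_right (by norm_num)).1 hbound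
  have hk := Submodule.finrank_mono hle
  refine ⟨hk.trans hk', fun heq => ?_⟩
  -- The bound holds for the enlarged code, so at the maximal dimension the all-one word was already
  -- in `C`.
  have hC := Submodule.eq_of_le_of_finrank_eq hle (by omega)
  rw [← hC] at hsat
  exact hsat.classification ha (by rw [hpow, BinaryCode.card_words, heq])
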